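/- For vectors $c_1,\dots,c_m\in\mathbb{R}^4$ let $[c_1,\dots,c_m]\subset\mathbb{RP}^3$ be the set of points represented by nonzero vectors $\sum_i t_ic_i$ with all $t_i\ge 0$. Let $V=[(0,0,0,1),(1,0,0,1),(1,1,0,1),(1,1,1,1)]$, that is, the set of points $(x:y:z:1)$ with $0\le z\le y\le x\le 1$, and let $$\mathsf{AB}=[(0,0,0,1),(1,0,0,1),(1,1,0,1)],\qquad \mathsf{AC}=[(0,0,0,1),(1,0,0,1),(1,1,1,1)]$$ be two of its faces. Let $$A=\begin{pmatrix}1&0&0&0\\1&0&-1&0\\0&1&-1&0\\0&0&-1&1\end{pmatrix},\qquad B=\begin{pmatrix}0&0&-1&1\\1&0&-1&0\\0&1&-1&0\\1&0&0&0\end{pmatrix},$$ and for $n\ge 1$ let $\mathbf{A}_n=BA^{3n-1}$, $\mathbf{B}_n=BA^{3n-2}$, $\mathbf{C}_n=BA^{3n-3}$. Define the pieces $$\mathbb{A}_n=\mathbf{A}_n^{-1}V\setminus[(1,0,0,n+1),(1,1,0,n+1),(1,1,1,n+1)],$$ $$\mathbb{B}_n=\mathbf{B}_n^{-1}V\setminus[(1,0,0,n),(1,1,0,n+1),(1,1,1,n+1)],$$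 $$\mathbb{C}_n=\mathbf{C}_n^{-1}V\setminus[(1,0,0,n),(1,1,0,n),(1,1,1,n+1)];$$ they partition $V\setminus\{\mathbf{0}\}$, where $\mathbf{0}=(0:0:0:1)$. The three-dimensional Gauss map $G:V\to V$ is given by $G(\mathbf{v})=\mathbf{X}_n\mathbf{v}$ for $\mathbf{v}\in\mathbb{X}_n$ ($\mathbb{X}\in\{\mathbb{A},\mathbb{B},\mathbb{C}\}$) and $G(\mathbf{0})=\mathbf{0}$. The itinerary of $\mathbf{v}\in V$ is the sequence of symbols of the pieces that contain $\mathbf{v},G(\mathbf{v}),G^2(\mathbf{v}),\dots$; it is infinite if the orbit never reaches $\mathbf{0}$, and otherwise it is finite and stops when the orbit reaches $\mathbf{0}$. Consider the directed graph with the two nodes $\mathsf{AB}$ and $\mathsf{AC}$ and, for every $n\ge 1$, the labelled edges $$\mathsf{AB}\xrightarrow{\mathbb{A}_n}\mathsf{AB},\qquad \mathsf{AC}\xrightarrow{\mathbb{A}_n}\mathsf{AC},\qquad \mathsf{AB}\xrightarrow{\mathbb{B}_n}\mathsf{AC},\qquad \mathsf{AC}\xrightarrow{\mathbb{C}_n}\mathsf{AB}.$$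 **Proposition.** For every point $\mathbf{v}\in V$: the itinerary of $\mathbf{v}$ is the sequence of labels along a (finite or infinite) path of this graph starting at the node $\mathsf{AB}$ if and only if $\mathbf{v}$ lies on the face $\mathsf{AB}$; and it is the sequence of labels along a path starting at the node $\mathsf{AC}$ if and only if $\mathbf{v}$ lies on the face $\mathsf{AC}$. -/

import Mathlib

open scoped LinearAlgebra.Projectivization MatrixGroups Pointwise

noncomputable section

namespace Gauss3

/-- Real projective 3-space, in homogeneous coordinates. -/
abbrev RP3 : Type := ℙ ℝ (Fin 4 → ℝ)

/-- The simplex in projective space whose vertices have the vectors `c i` as homogeneous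
coordinates: all points represented by a (nonzero) nonnegative combination of the `c i`. -/
def simplex {m : ℕ} (c : Fin m → Fin 4 → ℝ) : Set RP3 :=
  {p | ∃ (t : Fin m → ℝ) (h : ∑ i, t i • c i ≠ 0),
    (∀ i, 0 ≤ t i) ∧ p = Projectivization.mk ℝ (∑ i, t i • c i) h}

/-- The base tetrahedron, i.e. the points `[x : y : z : 1]` with `0 ≤ z ≤ y ≤ x ≤ 1`. -/
def V : Set RP3 :=
  simplex ![![0, 0, 0, 1], ![1, 0, 0, 1], ![1, 1, 0, 1], ![1, 1, 1, 1]]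

/-- The face `AB` of the base tetrahedron. -/
def faceAB : Set RP3 :=
  simplex ![![0, 0, 0, 1], ![1, 0, 0, 1], ![1, 1, 0, 1]]

/-- The face `AC` of the base tetrahedron. -/
def faceAC : Set RP3 :=
  simplex ![![0, 0, 0, 1], ![1, 0, 0, 1], ![1, 1, 1, 1]]

/-- The matrix `A` of the Mönkemeyer map. -/
def matA : GL (Fin 4) ℝ :=
  Matrix.GeneralLinearGroup.mkOfDetNeZero
    !![1, 0, 0, 0; 1, 0, -1, 0; 0, 1, -1, 0; 0, 0, -1, 1]
    (by simp [Matrix.det_succ_row_zero, Fin.sum_univ_succ, Fin.succAbove])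

/-- The matrix `B` of the Mönkemeyer map. -/
def matB : GL (Fin 4) ℝ :=
  Matrix.GeneralLinearGroup.mkOfDetNeZero
    !![0, 0, -1, 1; 1, 0, -1, 0; 0, 1, -1, 0; 1, 0, 0, 0]
    (by simp [Matrix.det_succ_row_zero, Fin.sum_univ_succ, Fin.succAbove])

/-- The alphabet `{A_n, B_n, C_n : n ≥ 1}`. -/
inductive Symb : Type
  | A (n : ℕ+)
  | B (n : ℕ+)
  | C (n : ℕ+)

/-- The matrices `A_n = B A^(3n-1)`, `B_n = B A^(3n-2)` and `C_n = B A^(3n-3)`. -/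
def Symb.mat : Symb → GL (Fin 4) ℝ
  | .A n => matB * matA ^ (3 * (n : ℕ) - 1)
  | .B n => matB * matA ^ (3 * (n : ℕ) - 2)
  | .C n => matB * matA ^ (3 * (n : ℕ) - 3)

/-- The face of the closed tetrahedron `s.mat⁻¹ • V` that does not belong to the piece
with symbol `s` (it is the one that `s.mat` maps to the frontal face `x = 1` of `V`). -/
def Symb.excludedFace : Symb → Set RP3
  | .A n => simplex ![![1, 0, 0, (n : ℝ) + 1], ![1, 1, 0, (n : ℝ) + 1], ![1, 1, 1, (n : ℝ) + 1]]
  | .B n => simplex ![![1, 0, 0, (n : ℝ)], ![1, 1, 0, (n : ℝ) + 1], ![1, 1, 1, (n : ℝ) + 1]]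
  | .C n => simplex ![![1, 0, 0, (n : ℝ)], ![1, 1, 0, (n : ℝ)], ![1, 1, 1, (n : ℝ) + 1]]

/-- The piece of the partition with symbol `s`. These pieces are pairwise disjoint and
cover all of `V` except the vertex `[0 : 0 : 0 : 1]`. -/
def Symb.piece (s : Symb) : Set RP3 := (s.mat⁻¹ • V) \ s.excludedFace

/-- The vertex `[0 : 0 : 0 : 1]` of `V`. -/
def origin : V :=
  ⟨Projectivization.mk ℝ ![0, 0, 0, 1] (fun h => by simpa using congrFun h 3),
    ![1, 0, 0, 0], by
      have e : ∑ i, (![1, 0, 0, 0] : Fin 4 → ℝ) i •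
          (![![0, 0, 0, 1], ![1, 0, 0, 1], ![1, 1, 0, 1], ![1, 1, 1, 1]] : Fin 4 → Fin 4 → ℝ) i
          = ![0, 0, 0, 1] := by simp [Fin.sum_univ_succ]
      refine ⟨fun h => ?_, fun i => ?_, ?_⟩
      · rw [e] at h
        simpa using congrFun h 3
      · fin_cases i <;> simp
      · congr 1
        exact e.symm⟩

open Classical in
/-- The symbol of the piece that contains `v`; there is none exactly when `v` is the origin. -/
def symbolAt (v : V) : Option Symb :=
  if h : ∃ s : Symb, (v : RP3) ∈ s.piece then some h.choose else none

theorem mem_piece_of_symbolAt {v : V} {s : Symb} (h : symbolAt v = some s) :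
    (v : RP3) ∈ s.piece := by
  unfold symbolAt at h
  split_ifs at h with h'
  cases h
  exact h'.choose_spec

/-- The three-dimensional Gauss map: multiplication by the matrix of the piece that contains
the point; the origin is mapped to itself. -/
def gaussMap (v : V) : V :=
  match h : symbolAt v with
  | some s => ⟨s.mat • (v : RP3), Set.mem_inv_smul_set_iff.mp (mem_piece_of_symbolAt h).1⟩
  | none => origin

/-- The itinerary of `v`: its `k`-th entry is the symbol of the piece that contains the `k`-th
iterate of `v`. The itinerary is finite (all further entries are `none`) if and only if the
orbit of `v` reaches the origin. -/
def itinerary (v : V) (k : ℕ) : Option Symb := symbolAt (gaussMap^[k] v)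

/-- The nodes of the graph. -/
inductive Node : Type
  | AB
  | AC

/-- The labelled edges of the graph. -/
inductive Edge : Node → Symb → Node → Prop
  | loopAB (n : ℕ+) : Edge .AB (.A n) .AB
  | loopAC (n : ℕ+) : Edge .AC (.A n) .AC
  | switchB (n : ℕ+) : Edge .AB (.B n) .AC
  | switchC (n : ℕ+) : Edge .AC (.C n) .AB

/-- The (finite or infinite) word `w` is the sequence of labels along a path of the graph
that starts at the node `s`. -/
def FollowsGraph (s : Node) (w : ℕ → Option Symb) : Prop :=
  ∃ q : ℕ → Node, q 0 = s ∧ ∀ k a, w k = some a → Edge (q k) a (q (k + 1))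

end Gauss3

end

namespace Gauss3

/-! Fix homogeneous coordinates in the cone over `V` and let the matrices act on them without
renormalising. Each node has a linear form, its `defect`, which is nonnegative on the cone and
vanishes exactly on the face. Along every edge the defect at the target of the image equals the
defect at the source (`Edge.defect_act`).

From face to path: on a face the symbols without an outgoing edge cannot occur, since such a closed
tetrahedron meets that face only inside its excluded face (`exists_edge`). Preservation of the
defect keeps the orbit on the faces.

From path to face: `Node.potential` is nonnegative and drops at each step by at least the defect,
which is constant along the path. A positive defect rules out reaching the origin, so the descent
would never end, which is impossible. -/

/-! ### Representatives in the cone, and the faces as zero sets of linear forms. -/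

/-- The convex cone in `ℝ⁴` over the base tetrahedron. -/
structure InCone (u : Fin 4 → ℝ) : Prop where
  nonneg : 0 ≤ u 2
  le₁ : u 2 ≤ u 1
  le₀ : u 1 ≤ u 0
  le₃ : u 0 ≤ u 3
  pos : 0 < u 3

theorem InCone.ne_zero {u : Fin 4 → ℝ} (hu : InCone u) : u ≠ 0 := by
  rintro rfl
  exact lt_irrefl _ hu.pos

/-- The vector `u` of the cone consists of homogeneous coordinates of the point `p`. -/
def IsRep (p : RP3) (u : Fin 4 → ℝ) : Prop :=
  ∃ hu : InCone u, p = Projectivization.mk ℝ u hu.ne_zero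

theorem mk_mem_simplex_iff {m : ℕ} {c : Fin m → Fin 4 → ℝ} {u : Fin 4 → ℝ} (hu : u ≠ 0) :
    Projectivization.mk ℝ u hu ∈ simplex c ↔
      ∃ (t : Fin m → ℝ) (a : ℝ), (∀ i, 0 ≤ t i) ∧ a ≠ 0 ∧ u = a • ∑ i, t i • c i := by
  constructor
  · rintro ⟨t, h, ht, e⟩
    obtain ⟨a, ha⟩ := (Projectivization.mk_eq_mk_iff' ℝ _ _ hu h).1 e
    refine ⟨t, a, ht, ?_, ha.symm⟩
    rintro rfl
    exact hu (by rw [← ha, zero_smul])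
  · rintro ⟨t, a, ht, ha, e⟩
    have h : ∑ i, t i • c i ≠ 0 := fun h0 => hu (by rw [e, h0, smul_zero])
    exact ⟨t, h, ht, (Projectivization.mk_eq_mk_iff' ℝ _ _ hu h).2 ⟨a, e.symm⟩⟩

theorem mk_mem_simplex {m : ℕ} {c : Fin m → Fin 4 → ℝ} {u : Fin 4 → ℝ} (hu : u ≠ 0)
    (t : Fin m → ℝ) (ht : ∀ i, 0 ≤ t i) (e : u = ∑ i, t i • c i) :
    Projectivization.mk ℝ u hu ∈ simplex c :=
  (mk_mem_simplex_iff hu).2 ⟨t, 1, ht, one_ne_zero, by rw [one_smul, e]⟩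

theorem mk_mem_V {u : Fin 4 → ℝ} (hu : InCone u) :
    Projectivization.mk ℝ u hu.ne_zero ∈ V := by
  -- The weights are the slacks of the chain `0 ≤ u 2 ≤ u 1 ≤ u 0 ≤ u 3`.
  refine mk_mem_simplex _ ![u 3 - u 0, u 0 - u 1, u 1 - u 2, u 2] ?_ ?_
  · intro i
    have := hu.nonneg
    have := hu.le₁
    have := hu.le₀
    have := hu.le₃
    fin_cases i <;> simpa
  · ext i
    fin_cases i <;> simp [Fin.sum_univ_succ]

/-- A representative of a point of `V` with nonnegative last coordinate lies in the cone. -/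
theorem inCone_of_mk_mem_V {u : Fin 4 → ℝ} (hu : u ≠ 0) (h : Projectivization.mk ℝ u hu ∈ V)
    (h3 : 0 ≤ u 3) : InCone u := by
  obtain ⟨t, a, ht, ha, e⟩ := (mk_mem_simplex_iff hu).1 h
  have e0 : u 0 = a * (t 1 + (t 2 + t 3)) := by
    rw [e]; simp [Fin.sum_univ_succ]
  have e1 : u 1 = a * (t 2 + t 3) := by
    rw [e]; simp [Fin.sum_univ_succ]
  have e2 : u 2 = a * t 3 := by
    rw [e]; simp [Fin.sum_univ_succ]
  have e3 : u 3 = a * (t 0 + (t 1 + (t 2 + t 3))) := by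
    rw [e]; simp [Fin.sum_univ_succ]
  have t0 := ht 0
  have t1 := ht 1
  have t2 := ht 2
  have t3 := ht 3
  have hs : 0 < t 0 + (t 1 + (t 2 + t 3)) := by
    refine lt_of_le_of_ne (by positivity) fun hs => hu ?_
    have z0 : t 0 = 0 := by linarith
    have z1 : t 1 = 0 := by linarith
    have z2 : t 2 = 0 := by linarith
    have z3 : t 3 = 0 := by linarith
    ext i
    fin_cases i
    · simp [e0, z1, z2, z3]
    · simp [e1, z2, z3]
    · simp [e2, z3]
    · simp [e3, z0, z1, z2, z3]
  have hpos : 0 < a := by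
    rcases lt_or_gt_of_ne ha with h' | h'
    · nlinarith
    · exact h'
  constructor
  · rw [e2]; positivity
  · rw [e1, e2]; nlinarith
  · rw [e0, e1]; nlinarith
  · rw [e0, e3]; nlinarith
  · rw [e3]; positivity

theorem exists_isRep (v : V) : ∃ u, IsRep v u := by
  obtain ⟨p, hp⟩ := v
  induction p using Projectivization.ind with
  | h u hu =>
    rcases le_total 0 (u 3) with h | h
    · exact ⟨u, inCone_of_mk_mem_V hu hp h, rfl⟩
    · have e : Projectivization.mk ℝ u hu = Projectivization.mk ℝ (-u) (neg_ne_zero.2 hu) :=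
        (Projectivization.mk_eq_mk_iff' ℝ _ _ _ _).2 ⟨-1, by simp⟩
      exact ⟨-u, inCone_of_mk_mem_V (neg_ne_zero.2 hu) (e ▸ hp) (by simpa using h), e⟩

/-- The face of the base tetrahedron that corresponds to a node. -/
def Node.face : Node → Set RP3
  | .AB => faceAB
  | .AC => faceAC

/-- The linear form that cuts out the face of a node on the cone. -/
def Node.defect : Node → (Fin 4 → ℝ) → ℝ
  | .AB, u => u 2
  | .AC, u => u 1 - u 2

theorem mem_face_iff {p : RP3} {u : Fin 4 → ℝ} (h : IsRep p u) (q : Node) :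
    p ∈ q.face ↔ q.defect u = 0 := by
  obtain ⟨hu, rfl⟩ := h
  have h2 := hu.nonneg
  have h1 := hu.le₁
  have h0 := hu.le₀
  have h3 := hu.le₃
  cases q with
  | AB =>
    constructor
    · intro h
      obtain ⟨t, a, -, -, e⟩ := (mk_mem_simplex_iff hu.ne_zero).1 h
      rw [e]
      simp [Node.defect, Fin.sum_univ_succ]
    · intro h
      have h : u 2 = 0 := h
      refine mk_mem_simplex _ ![u 3 - u 0, u 0 - u 1, u 1] ?_ ?_
      · intro i
        fin_cases i
        · simpa
        · simpa
        · simpa using h2.trans h1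
      · ext i
        fin_cases i <;> simp [Fin.sum_univ_succ, h]
  | AC =>
    constructor
    · intro h
      obtain ⟨t, a, -, -, e⟩ := (mk_mem_simplex_iff hu.ne_zero).1 h
      rw [e]
      simp [Node.defect, Fin.sum_univ_succ]
    · intro h
      have h : u 1 = u 2 := sub_eq_zero.1 h
      refine mk_mem_simplex _ ![u 3 - u 0, u 0 - u 1, u 1] ?_ ?_
      · intro i
        fin_cases i
        · simpa
        · simpa
        · simpa using h2.trans h1
      · ext i
        fin_cases i <;> simp [Fin.sum_univ_succ, h]

/-! ### The matrices in coordinates. -/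

theorem matA_smul (u : Fin 4 → ℝ) : matA • u = ![u 0, u 0 - u 2, u 1 - u 2, u 3 - u 2] := by
  change Matrix.mulVec !![1, 0, 0, 0; 1, 0, -1, 0; 0, 1, -1, 0; 0, 0, -1, 1] u = _
  ext i
  fin_cases i <;> simp [Matrix.mulVec, dotProduct, Fin.sum_univ_succ] <;> ring

theorem matB_smul (u : Fin 4 → ℝ) :
    matB • u = ![u 3 - u 2, u 0 - u 2, u 1 - u 2, u 0] := by
  change Matrix.mulVec !![0, 0, -1, 1; 1, 0, -1, 0; 0, 1, -1, 0; 1, 0, 0, 0] u = _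
  ext i
  fin_cases i <;> simp [Matrix.mulVec, dotProduct, Fin.sum_univ_succ] <;> ring

/-- `A ^ 3` only subtracts the first coordinate from the last, so the subscript `n` of a symbol
counts steps of a Euclidean division of `u 3` by `u 0`. -/
theorem matA_pow_three_mul_smul (k : ℕ) (u : Fin 4 → ℝ) :
    matA ^ (3 * k) • u = ![u 0, u 1, u 2, u 3 - k * u 0] := by
  induction k with
  | zero =>
    ext i
    fin_cases i <;> simp
  | succ k ih =>
    rw [show 3 * (k + 1) = 1 + (1 + (1 + 3 * k)) by ring, pow_add, pow_add, pow_add, pow_one,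
      mul_smul, mul_smul, mul_smul, ih, matA_smul, matA_smul, matA_smul]
    ext i
    fin_cases i <;> simp
    ring

/-- The action of the matrix of a symbol in coordinates. -/
def Symb.act : Symb → (Fin 4 → ℝ) → Fin 4 → ℝ
  | .A n, u => ![u 3 - n * u 0, u 1, u 2, u 0]
  | .B n, u => ![u 3 - (n - 1) * u 0 - u 1, u 0 - u 1 + u 2, u 0 - u 1, u 0]
  | .C n, u => ![u 3 - (n - 1) * u 0 - u 2, u 0 - u 2, u 1 - u 2, u 0]

theorem mat_smul (s : Symb) (u : Fin 4 → ℝ) : s.mat • u = s.act u := by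
  -- Writing `n = k + 1` removes the truncated subtractions: the exponents become `3k + 2`, `3k +
  -- 1`, `3k`.
  have key (n : ℕ+) : ∃ k : ℕ, (n : ℕ) = k + 1 := ⟨n - 1, (Nat.sub_add_cancel n.pos).symm⟩
  cases s with
  | A n =>
    obtain ⟨k, hk⟩ := key n
    have hk' : ((n : ℕ) : ℝ) = k + 1 := by exact_mod_cast hk
    rw [Symb.mat, Symb.act, show 3 * (n : ℕ) - 1 = 1 + (1 + 3 * k) by lia, pow_add, pow_add,
      pow_one, mul_smul, mul_smul, mul_smul, matA_pow_three_mul_smul, matA_smul, matA_smul,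
      matB_smul, hk']
    ext i
    fin_cases i <;> simp
    ring
  | B n =>
    obtain ⟨k, hk⟩ := key n
    have hk' : ((n : ℕ) : ℝ) = k + 1 := by exact_mod_cast hk
    rw [Symb.mat, Symb.act, show 3 * (n : ℕ) - 2 = 1 + 3 * k by lia, pow_add,
      pow_one, mul_smul, mul_smul, matA_pow_three_mul_smul, matA_smul, matB_smul, hk']
    ext i
    fin_cases i <;> simp
    ring
  | C n =>
    obtain ⟨k, hk⟩ := key n
    have hk' : ((n : ℕ) : ℝ) = k + 1 := by exact_mod_cast hk
    rw [Symb.mat, Symb.act, show 3 * (n : ℕ) - 3 = 3 * k by lia, mul_smul,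
      matA_pow_three_mul_smul, matB_smul, hk']
    ext i
    fin_cases i <;> simp

theorem act_last (s : Symb) (u : Fin 4 → ℝ) : s.act u 3 = u 0 := by
  cases s <;> rfl

theorem act_ne_zero (s : Symb) {u : Fin 4 → ℝ} (hu : u ≠ 0) : s.act u ≠ 0 := by
  rw [← mat_smul]
  exact (smul_ne_zero_iff_ne _).2 hu

theorem mat_smul_mk (s : Symb) {u : Fin 4 → ℝ} (hu : u ≠ 0) :
    s.mat • Projectivization.mk ℝ u hu = Projectivization.mk ℝ (s.act u) (act_ne_zero s hu) := by
  rw [Projectivization.smul_mk]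
  congr 1
  exact mat_smul s u

theorem mem_inv_smul_V_iff {p : RP3} {u : Fin 4 → ℝ} (h : IsRep p u) (s : Symb) :
    p ∈ s.mat⁻¹ • V ↔ InCone (s.act u) := by
  obtain ⟨hu, rfl⟩ := h
  rw [Set.mem_inv_smul_set_iff, mat_smul_mk]
  refine ⟨fun h => inCone_of_mk_mem_V _ h ?_, mk_mem_V⟩
  rw [act_last]
  exact hu.nonneg.trans (hu.le₁.trans hu.le₀)

/-- The linear relation satisfied on the excluded face: the first and the last coordinate of the
image agree. -/
theorem act_first_eq_of_mem_excludedFace {s : Symb} {u : Fin 4 → ℝ} (hu : u ≠ 0)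
    (h : Projectivization.mk ℝ u hu ∈ s.excludedFace) : s.act u 0 = u 0 := by
  cases s <;>
  · obtain ⟨t, a, -, -, e⟩ := (mk_mem_simplex_iff hu).1 h
    rw [e]
    simp [Symb.act, Fin.sum_univ_succ]
    ring

/-! ### The Gauss map on representatives, and the covering by pieces. -/

theorem isRep_gaussMap {v : V} {u : Fin 4 → ℝ} (h : IsRep v u) {s : Symb}
    (hs : symbolAt v = some s) : IsRep (gaussMap v) (s.act u) := by
  have hc := (mem_inv_smul_V_iff h s).1 (mem_piece_of_symbolAt hs).1
  refine ⟨hc, ?_⟩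
  obtain ⟨hu, e⟩ := h
  have hg : (gaussMap v : RP3) = s.mat • (v : RP3) := by
    unfold gaussMap
    split
    · next s' hs' =>
      rw [hs] at hs'
      cases hs'
      rfl
    · next hs' =>
      rw [hs] at hs'
      cases hs'
  rw [hg, e, mat_smul_mk]

theorem gaussMap_of_symbolAt_eq_none {v : V} (hs : symbolAt v = none) : gaussMap v = origin := by
  unfold gaussMap
  split
  · next s' hs' =>
    rw [hs] at hs'
    cases hs'
  · rfl

theorem origin_mem_face (q : Node) : (origin : RP3) ∈ q.face := by
  have h : IsRep origin ![0, 0, 0, 1] := ⟨by constructor <;> simp, rfl⟩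
  rw [mem_face_iff h]
  cases q <;> simp [Node.defect]

/-- The pieces cover all points of `V` other than the origin. -/
theorem exists_mem_piece {p : RP3} {u : Fin 4 → ℝ} (h : IsRep p u) (h0 : u 0 ≠ 0) :
    ∃ s : Symb, p ∈ s.piece := by
  have hu := h.1
  have c2 := hu.nonneg
  have c1 := hu.le₁
  have c0 := hu.le₀
  have c3 := hu.le₃
  have hx : 0 < u 0 := lt_of_le_of_ne (by linarith) h0.symm
  suffices ∃ s : Symb, InCone (s.act u) ∧ s.act u 0 ≠ u 0 by
    obtain ⟨s, hs, hne⟩ := this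
    refine ⟨s, (mem_inv_smul_V_iff h s).2 hs, fun hf => hne ?_⟩
    obtain ⟨hu, rfl⟩ := h
    exact act_first_eq_of_mem_excludedFace _ hf
  -- With `n = ⌊u 3 / u 0⌋`, comparing `u 3 - n * u 0` with `u 2 ≤ u 1` decides between the letters:
  -- C below `u 2`, B from `u 2` up to `u 1`, A from `u 1` on.
  have hn : 0 < ⌊u 3 / u 0⌋₊ := Nat.floor_pos.2 ((one_le_div hx).2 c3)
  obtain ⟨n, hn'⟩ : ∃ n : ℕ+, (n : ℕ) = ⌊u 3 / u 0⌋₊ := ⟨⟨_, hn⟩, rfl⟩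
  have l1 : (n : ℝ) * u 0 ≤ u 3 := by
    rw [← le_div_iff₀ hx, hn']
    exact Nat.floor_le (div_nonneg hu.pos.le hx.le)
  have l2 : u 3 < ((n : ℝ) + 1) * u 0 := by
    rw [← div_lt_iff₀ hx, hn']
    exact Nat.lt_floor_add_one _
  rcases le_or_gt ((n : ℝ) * u 0 + u 1) (u 3) with hA | hA
  · refine ⟨.A n, ?_, ?_⟩
    · constructor <;> simp [Symb.act] <;> linarith
    · simp only [Symb.act, Matrix.cons_val_zero]
      apply ne_of_lt
      linarith
  rcases le_or_gt ((n : ℝ) * u 0 + u 2) (u 3) with hB | hB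
  · refine ⟨.B n, ?_, ?_⟩
    · constructor <;> simp [Symb.act] <;> linarith
    · simp only [Symb.act, Matrix.cons_val_zero]
      apply ne_of_lt
      linarith
  · refine ⟨.C n, ?_, ?_⟩
    · constructor <;> simp [Symb.act] <;> linarith
    · simp only [Symb.act, Matrix.cons_val_zero]
      apply ne_of_lt
      linarith

theorem defect_eq_zero_of_symbolAt_eq_none {v : V} {u : Fin 4 → ℝ} (h : IsRep v u)
    (hs : symbolAt v = none) (q : Node) : q.defect u = 0 := by
  have h0 : u 0 = 0 := by
    by_contra h0
    have hex := exists_mem_piece h h0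
    rw [symbolAt, dif_pos hex] at hs
    cases hs
  have c2 := h.1.nonneg
  have c1 := h.1.le₁
  have c0 := h.1.le₀
  cases q <;> simp only [Node.defect] <;> linarith

/-! ### From faces to paths. -/

theorem Edge.defect_act {q q' : Node} {s : Symb} (h : Edge q s q') (u : Fin 4 → ℝ) :
    q'.defect (s.act u) = q.defect u := by
  cases h <;> simp [Node.defect, Symb.act]

/-- A point of a face has a symbol that labels an edge starting at the node of the face. -/
theorem exists_edge {p : RP3} {u : Fin 4 → ℝ} (h : IsRep p u) {s : Symb} (hs : p ∈ s.piece)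
    {q : Node} (hq : q.defect u = 0) : ∃ q', Edge q s q' := by
  have hc := (mem_inv_smul_V_iff h s).1 hs.1
  have hne := hs.2
  obtain ⟨hu, rfl⟩ := h
  have c2 := hu.nonneg
  have c1 := hu.le₁
  have c0 := hu.le₀
  have d0 := hc.le₀
  have d3 := hc.le₃
  cases s with
  | A n => cases q with
    | AB => exact ⟨_, .loopAB n⟩
    | AC => exact ⟨_, .loopAC n⟩
  | B n => cases q with
    | AB => exact ⟨_, .switchB n⟩
    | AC =>
      have hq : u 1 = u 2 := sub_eq_zero.1 hq
      simp only [Symb.act, Matrix.cons_val] at d0 d3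
      -- A piece of type B requires `n * u 0 + u 2 ≤ u 3 ≤ n * u 0 + u 1`; on `AC` both bounds
      -- coincide, which forces the point onto the excluded face.
      have h3 : u 3 = n * u 0 + u 2 := by linarith
      refine (hne (mk_mem_simplex _ ![u 0 - u 2, 0, u 2] ?_ ?_)).elim
      · intro i
        fin_cases i
        · simpa using c1.trans c0
        · simp
        · simpa
      · ext i
        fin_cases i <;> simp [Fin.sum_univ_succ, hq, h3]
        ring
  | C n => cases q with
    | AC => exact ⟨_, .switchC n⟩
    | AB =>
      have hq : u 2 = 0 := hq
      simp only [Symb.act, Matrix.cons_val] at d0 d3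
      -- Here the bounds are `n * u 0 ≤ u 3 ≤ n * u 0 + u 2`, which coincide on `AB`.
      have h3 : u 3 = n * u 0 := by linarith
      refine (hne (mk_mem_simplex _ ![u 0 - u 1, u 1, 0] ?_ ?_)).elim
      · intro i
        fin_cases i
        · simpa using c0
        · simpa using c2.trans c1
        · simp
      · ext i
        fin_cases i <;> simp [Fin.sum_univ_succ, hq, h3]
        ring

/-- The face hypothesis stands inside the existential so that `choose` yields a total successor
function, to be iterated along the orbit. -/
theorem exists_next_node (v : V) (q : Node) : ∃ q' : Node, (v : RP3) ∈ q.face →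
    (∀ s, symbolAt v = some s → Edge q s q') ∧ (gaussMap v : RP3) ∈ q'.face := by
  by_cases hv : (v : RP3) ∈ q.face
  · obtain ⟨u, hu⟩ := exists_isRep v
    have hd := (mem_face_iff hu q).1 hv
    cases hs : symbolAt v with
    | none =>
      refine ⟨q, fun _ => ⟨nofun, ?_⟩⟩
      rw [gaussMap_of_symbolAt_eq_none hs]
      exact origin_mem_face q
    | some s =>
      obtain ⟨q', he⟩ := exists_edge hu (mem_piece_of_symbolAt hs) hd
      refine ⟨q', fun _ => ⟨fun s' h => (Option.some.inj h) ▸ he, ?_⟩⟩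
      rw [mem_face_iff (isRep_gaussMap hu hs), he.defect_act, hd]
  · exact ⟨q, fun h => absurd h hv⟩

theorem followsGraph_of_mem_face {v : V} {q₀ : Node} (hv : (v : RP3) ∈ q₀.face) :
    FollowsGraph q₀ (itinerary v) := by
  choose next hnext using exists_next_node
  let q : ℕ → Node := fun k => Nat.rec q₀ (fun k r => next (gaussMap^[k] v) r) k
  have hq (k : ℕ) : (gaussMap^[k] v : RP3) ∈ (q k).face := by
    induction k with
    | zero => exact hv
    | succ k ih =>
      rw [Function.iterate_succ_apply']
      exact (hnext _ _ ih).2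
  exact ⟨q, rfl, fun k a hk => (hnext _ _ (hq k)).1 a hk⟩

/-! ### From paths to faces, by descent. -/

/-- A function on the cone that decreases along every edge by at least the defect. -/
def Node.potential : Node → (Fin 4 → ℝ) → ℝ
  | .AB, u => 2 * (u 3 + u 0)
  | .AC, u => 2 * (u 3 + u 0) + (u 1 - u 2)

theorem potential_nonneg (q : Node) {u : Fin 4 → ℝ} (hu : InCone u) : 0 ≤ q.potential u := by
  have c2 := hu.nonneg
  have c1 := hu.le₁
  have c0 := hu.le₀
  have c3 := hu.le₃
  cases q <;> simp only [Node.potential] <;> linarith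

theorem defect_nonneg (q : Node) {u : Fin 4 → ℝ} (hu : InCone u) : 0 ≤ q.defect u := by
  have c2 := hu.nonneg
  have c1 := hu.le₁
  cases q <;> simp only [Node.defect] <;> linarith

/-- On the edge labelled `C_1` the sum `u 3 + u 0` drops only by `u 2`, possibly zero; the extra
term `u 1 - u 2` at `AC` pays for the defect there. Edges of type B must then create a term `u 2` as
well as pay the defect `u 2`, whence the factor 2: their sum drops by at least `u 1 ≥ u 2`. -/
theorem Edge.potential_act_add_defect_le {q q' : Node} {s : Symb} (h : Edge q s q')
    {u : Fin 4 → ℝ} (hu : InCone u) :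
    q'.potential (s.act u) + q.defect u ≤ q.potential u := by
  have c2 := hu.nonneg
  have c1 := hu.le₁
  have c0 := hu.le₀
  have hx : 0 ≤ u 0 := by linarith
  cases h with
  | loopAB n | loopAC n | switchB n | switchC n =>
    have hn : 0 ≤ ((n : ℝ) - 1) * u 0 :=
      mul_nonneg (sub_nonneg.2 (Nat.one_le_cast.2 n.pos)) hx
    simp only [Node.potential, Node.defect, Symb.act, Matrix.cons_val]
    linarith

theorem mem_face_of_followsGraph {v : V} {q₀ : Node} (h : FollowsGraph q₀ (itinerary v)) :
    (v : RP3) ∈ q₀.face := by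
  obtain ⟨q, rfl, hq⟩ := h
  obtain ⟨u₀, hu₀⟩ := exists_isRep v
  rw [mem_face_iff hu₀]
  by_contra hd
  set d := (q 0).defect u₀ with hd_def
  have hpos : 0 < d := lt_of_le_of_ne (defect_nonneg _ hu₀.1) (Ne.symm hd)
  have key (k : ℕ) : ∃ u, IsRep (gaussMap^[k] v) u ∧ (q k).defect u = d ∧
      (q k).potential u + k * d ≤ (q 0).potential u₀ := by
    induction k with
    | zero => exact ⟨u₀, hu₀, rfl, by simp⟩
    | succ k ih =>
      obtain ⟨u, hu, hdu, hp⟩ := ih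
      cases hs : symbolAt (gaussMap^[k] v) with
      -- Where the itinerary stops every defect vanishes, so with `d > 0` this case cannot occur.
      | none => exact absurd (hdu.symm.trans (defect_eq_zero_of_symbolAt_eq_none hu hs _)) hd
      | some s =>
        have he := hq k s hs
        refine ⟨s.act u, ?_, (he.defect_act u).trans hdu, ?_⟩
        · rw [Function.iterate_succ_apply']
          exact isRep_gaussMap hu hs
        · have := he.potential_act_add_defect_le hu.1
          push_cast
          linarith
  obtain ⟨k, hk⟩ := exists_nat_gt ((q 0).potential u₀ / d)
  rw [div_lt_iff₀ hpos] at hk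
  obtain ⟨u, hu, -, hp⟩ := key k
  linarith [potential_nonneg (q k) hu.1]

theorem followsGraph_iff_mem_face (v : V) (q : Node) :
    FollowsGraph q (itinerary v) ↔ (v : RP3) ∈ q.face :=
  ⟨mem_face_of_followsGraph, followsGraph_of_mem_face⟩

end Gauss3

theorem mainTheorem6 (v : Gauss3.V) :
    (Gauss3.FollowsGraph .AB (Gauss3.itinerary v) ↔ (v : Gauss3.RP3) ∈ Gauss3.faceAB) ∧
    (Gauss3.FollowsGraph .AC (Gauss3.itinerary v) ↔ (v : Gauss3.RP3) ∈ Gauss3.faceAC) :=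
  ⟨Gauss3.followsGraph_iff_mem_face v .AB, Gauss3.followsGraph_iff_mem_face v .AC⟩
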